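/- Let $A$ denote the Glaisher--Kinkelin constant, i.e. the (positive) limit $$A=\lim_{n\to\infty}\frac{\prod_{\nu=1}^{n}\nu^{\nu}}{n^{\frac{n(n+1)}{2}+\frac1{12}}\,e^{-n^2/4}}=1.28242712\ldots,$$ let $\gamma$ be Euler's constant and $\Gamma$ the Gamma function. Then, as $n\to\infty$ through the positive integers, $$\prod_{\nu=1}^{n-1}\Gamma\!\left(\frac{\nu}{n}\right)^{\nu}\;\sim\;\frac{e^{\frac{1-\gamma}{12}}}{A}\left(\frac{(2\pi)^{1/4}}{A}\right)^{n^2}\Big/\,n^{1/12},$$ where $f\sim g$ means $\lim_{n\to\infty} f(n)/g(n)=1$. The constants have the decimal expansions $$\frac{e^{\frac{1-\gamma}{12}}}{A}=0.8077340270\ldots,\qquad \frac{(2\pi)^{1/4}}{A}=1.2345601953\ldots,$$ that is, the first lies in $[0.8077340270,\,0.8077340271)$ and the second in $[1.2345601953,\,1.2345601954)$. -/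

import Mathlib

/-- The quotient `(∏_{ν=1}^n ν^ν) / (n^{n(n+1)/2 + 1/12} e^{-n²/4})`, whose limit is the
Glaisher–Kinkelin constant. -/
noncomputable def glaisherKinkelinSeq (n : ℕ) : ℝ :=
  (∏ ν ∈ Finset.Icc 1 n, (ν : ℝ) ^ ν) /
    ((n : ℝ) ^ ((n : ℝ) * (n + 1) / 2 + 1 / 12) * Real.exp (-(n : ℝ) ^ 2 / 4))

/-- The Glaisher–Kinkelin constant `A = 1.28242…`; the limit exists and is positive, see
`glaisherKinkelin_pos` and `tendsto_glaisherKinkelinSeq`. -/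
noncomputable def glaisherKinkelin : ℝ := Filter.limUnder Filter.atTop glaisherKinkelinSeq

theorem glaisherKinkelinSeq_pos (n : ℕ) (hn : 1 ≤ n) : 0 < glaisherKinkelinSeq n := by
  have h0 : (0 : ℝ) < n := by exact_mod_cast hn
  refine div_pos (Finset.prod_pos fun ν hν => ?_) (by positivity)
  have : (0 : ℝ) < ν := by exact_mod_cast (Finset.mem_Icc.mp hν).1
  positivity

theorem log_glaisherKinkelinSeq_sub (n : ℕ) (hn : 1 ≤ n) :
    Real.log (glaisherKinkelinSeq (n + 1)) - Real.log (glaisherKinkelinSeq n) =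
      (2 * (n : ℝ) + 1) / 4 - ((n : ℝ) * (n + 1) / 2 + 1 / 12) * Real.log (1 + (n : ℝ)⁻¹) := by
  have h0 : (0 : ℝ) < n := by exact_mod_cast hn
  have h1 : (0 : ℝ) < (n : ℝ) + 1 := by positivity
  have hP : (∏ ν ∈ Finset.Icc 1 n, (ν : ℝ) ^ ν) ≠ 0 := by
    refine Finset.prod_ne_zero_iff.mpr fun ν hν => ?_
    have : (0 : ℝ) < ν := by exact_mod_cast (Finset.mem_Icc.mp hν).1
    positivity
  have h2 : Real.log (1 + (n : ℝ)⁻¹) = Real.log ((n : ℝ) + 1) - Real.log n := by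
    rw [← Real.log_div h1.ne' h0.ne']
    congr 1
    field_simp
  unfold glaisherKinkelinSeq
  rw [Finset.prod_Icc_succ_top (by omega), h2, Real.log_div (by positivity) (by positivity),
    Real.log_div (by positivity) (by positivity), Real.log_mul hP (by positivity),
    Real.log_mul (by positivity) (by positivity),
    Real.log_mul (by positivity) (by positivity), Real.log_exp, Real.log_exp, Real.log_pow,
    Real.log_rpow (by positivity), Real.log_rpow h0]
  push_cast
  ring

theorem abs_log_glaisherKinkelinSeq_sub_le (n : ℕ) (hn : 1 ≤ n) :
    |Real.log (glaisherKinkelinSeq (n + 1)) - Real.log (glaisherKinkelinSeq n)| ≤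
      1 / (n : ℝ) ^ 2 := by
  have h0 : (1 : ℝ) ≤ n := by exact_mod_cast hn
  rw [log_glaisherKinkelinSeq_sub n hn]
  have hs := Real.hasSum_log_one_add_inv (a := (n : ℝ)) (by positivity)
  obtain ⟨x, hx⟩ : ∃ x : ℝ, x = 1 / (2 * (n : ℝ) + 1) := ⟨_, rfl⟩
  have hx0 : 0 < x := by rw [hx]; positivity
  have hx3 : x ≤ 1 / 3 := by
    rw [hx]; exact one_div_le_one_div_of_le (by norm_num) (by linarith)
  have hxn : x ≤ 1 / n := by
    rw [hx]; exact one_div_le_one_div_of_le (by positivity) (by linarith)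
  have hxx : (n : ℝ) = (1 / x - 1) / 2 := by rw [hx]; field_simp; ring
  rw [← hx] at hs
  set S := Real.log (1 + (n : ℝ)⁻¹)
  have hlow : 2 * x + 2 * x ^ 3 / 3 ≤ S := by
    have := sum_le_hasSum (Finset.range 2) (fun k _ => by positivity) hs
    simp only [Finset.sum_range_succ, Finset.sum_range_zero] at this
    norm_num at this
    linarith
  have hup : S ≤ 2 * x + 2 * x ^ 3 / 3 + x ^ 5 / 2 := by
    have ht := (hasSum_nat_add_iff' 2).mpr hs
    have hq : x ^ 2 ≤ 1 / 9 := by nlinarith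
    have hg := (hasSum_geometric_of_lt_one (sq_nonneg x) (by linarith)).mul_left (2 / 5 * x ^ 5)
    have hle := hasSum_le (fun k => ?_) ht hg
    · simp only [Finset.sum_range_succ, Finset.sum_range_zero] at hle
      norm_num at hle
      have hi : (1 - x ^ 2)⁻¹ ≤ 9 / 8 := by
        rw [inv_le_comm₀ (by linarith) (by norm_num)]; linarith
      have : 2 / 5 * x ^ 5 * (1 - x ^ 2)⁻¹ ≤ 2 / 5 * x ^ 5 * (9 / 8) :=
        mul_le_mul_of_nonneg_left hi (by positivity)
      nlinarith [pow_pos hx0 5]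
    · have e : x ^ (2 * (k + 2) + 1) = x ^ 5 * (x ^ 2) ^ k := by ring
      rw [e]
      have : (1 : ℝ) / (2 * ((k + 2 : ℕ) : ℝ) + 1) ≤ 1 / 5 :=
        one_div_le_one_div_of_le (by norm_num) (by push_cast; linarith [k.cast_nonneg (α := ℝ)])
      have h5 : 0 ≤ x ^ 5 * (x ^ 2) ^ k := by positivity
      nlinarith [mul_le_mul_of_nonneg_right this h5]
  have hu : (n : ℝ) * (n + 1) / 2 + 1 / 12 = 1 / (8 * x ^ 2) - 1 / 24 := by
    rw [hxx]; field_simp; ring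
  have hl : (2 * (n : ℝ) + 1) / 4 = 1 / (4 * x) := by rw [hxx]; field_simp; ring
  have hu0 : 0 ≤ 1 / (8 * x ^ 2) - 1 / 24 := by rw [← hu]; positivity
  have hb : x ^ 2 ≤ 1 / (n : ℝ) ^ 2 := by
    have := pow_le_pow_left₀ hx0.le hxn 2
    rwa [div_pow, one_pow] at this
  refine le_trans ?_ hb
  rw [hu, hl, abs_le]
  have e1 : (1 / (8 * x ^ 2) - 1 / 24) * (2 * x + 2 * x ^ 3 / 3) = 1 / (4 * x) - x ^ 3 / 36 := by
    field_simp; ring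
  have e2 : (1 / (8 * x ^ 2) - 1 / 24) * (x ^ 5 / 2) = x ^ 3 / 16 - x ^ 5 / 48 := by
    field_simp; ring
  have m1 := mul_le_mul_of_nonneg_left hlow hu0
  have m2 := mul_le_mul_of_nonneg_left hup hu0
  rw [mul_add _ (2 * x + 2 * x ^ 3 / 3), e2] at m2
  rw [e1] at m1 m2
  have p3 : x ^ 3 ≤ x ^ 2 := by nlinarith [pow_pos hx0 2]
  have p5 : 0 < x ^ 5 := by positivity
  have p2 : 0 < x ^ 3 := by positivity
  constructor <;> linarith

theorem exists_pos_tendsto_glaisherKinkelinSeq :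
    ∃ L : ℝ, 0 < L ∧ Filter.Tendsto glaisherKinkelinSeq Filter.atTop (nhds L) := by
  have hc : CauchySeq fun n : ℕ => Real.log (glaisherKinkelinSeq (n + 1)) := by
    have hs : Summable fun n : ℕ => 1 / ((n + 1 : ℕ) : ℝ) ^ 2 :=
      (summable_nat_add_iff (f := fun n : ℕ => 1 / (n : ℝ) ^ 2) 1).mpr
        (Real.summable_one_div_nat_pow.mpr one_lt_two)
    refine cauchySeq_of_dist_le_of_summable _ (fun n => ?_) hs
    rw [dist_comm, Real.dist_eq]
    exact abs_log_glaisherKinkelinSeq_sub_le (n + 1) (by omega)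
  obtain ⟨l, hl⟩ := cauchySeq_tendsto_of_complete hc
  refine ⟨Real.exp l, Real.exp_pos l, ?_⟩
  rw [← Filter.tendsto_add_atTop_iff_nat 1]
  refine ((Real.continuous_exp.tendsto l).comp hl).congr fun n => ?_
  exact Real.exp_log (glaisherKinkelinSeq_pos (n + 1) (by omega))

theorem tendsto_glaisherKinkelinSeq :
    Filter.Tendsto glaisherKinkelinSeq Filter.atTop (nhds glaisherKinkelin) := by
  obtain ⟨L, -, hL⟩ := exists_pos_tendsto_glaisherKinkelinSeq
  rwa [glaisherKinkelin, hL.limUnder_eq]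

theorem glaisherKinkelin_pos : 0 < glaisherKinkelin := by
  obtain ⟨L, h0, hL⟩ := exists_pos_tendsto_glaisherKinkelinSeq
  exact (tendsto_nhds_unique tendsto_glaisherKinkelinSeq hL).symm ▸ h0

/-! Put g(x) = x log Γ(1 + x). Since Γ(ν/n) = (n/ν) Γ(1 + ν/n), the logarithm of the product is n Σ
g(ν/n) minus Σ ν log ν plus an explicit multiple of log n (`log_prod_Gamma_pow`). The sum Σ ν log ν
is governed by the definition of A and gives the factors 1/A and n^(-1/12).

The function g is smooth on [0, 1] and vanishes at both ends, so Euler–Maclaurin gives n Σ g(ν/n) =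
n² ∫g + (g'(1) - g'(0))/12 + o(1) (`tendsto_mul_sum_sub_sq_mul_integral`). Here g'(0) = 0 and g'(1)
= 1 - γ, which explains e^((1-γ)/12). The growth rate comes from ∫g = log(2π)/4 - log A - 1/4
(`primitive_mulLogGamma_one_sub_zero`), found by integrating Euler's approximations of Γ explicitly:
the factorial brings in Stirling's formula, the logarithms telescope to Σ j log j.

For the decimals, log A and γ are squeezed between their defining sequences corrected by truncated
asymptotic expansions. These corrected sequences are monotone, and at n = 16 they need only
logarithms of small primes. -/

/-! ### Euler–Maclaurin summation on [0, 1]. -/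

theorem abs_le_of_abs_deriv_le_pow {φ φ' : ℝ → ℝ} {a b C : ℝ} (k : ℕ) (h0 : φ a = 0)
    (hd : ∀ t ∈ Set.Icc a b, HasDerivAt φ (φ' t) t)
    (hb : ∀ t ∈ Set.Icc a b, |φ' t| ≤ C * (t - a) ^ k) :
    ∀ t ∈ Set.Icc a b, |φ t| ≤ C / (k + 1) * (t - a) ^ (k + 1) := by
  have hB : ∀ x, HasDerivAt (fun t : ℝ => C / (k + 1) * (t - a) ^ (k + 1)) (C * (x - a) ^ k) x := by
    intro x
    have h := (((hasDerivAt_id x).sub_const a).pow (k + 1)).const_mul (C / ((k : ℝ) + 1))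
    refine h.congr_deriv ?_
    have : (k : ℝ) + 1 ≠ 0 := by positivity
    simp
    field_simp
  exact image_norm_le_of_norm_deriv_right_le_deriv_boundary
    (fun t ht => (hd t ht).continuousAt.continuousWithinAt)
    (fun t ht => (hd t (Set.Ico_subset_Icc_self ht)).hasDerivWithinAt)
    (by simp [h0]) hB (fun t ht => hb t (Set.Ico_subset_Icc_self ht))

/-- The trapezoidal rule on one interval with its first Euler–Maclaurin correction. -/
theorem abs_integral_sub_trapezoid_add_le {G g g₁ g₂ g₃ : ℝ → ℝ} {a b M : ℝ} (hab : a ≤ b)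
    (hG : ∀ t ∈ Set.Icc a b, HasDerivAt G (g t) t)
    (h1 : ∀ t ∈ Set.Icc a b, HasDerivAt g (g₁ t) t)
    (h2 : ∀ t ∈ Set.Icc a b, HasDerivAt g₁ (g₂ t) t)
    (h3 : ∀ t ∈ Set.Icc a b, HasDerivAt g₂ (g₃ t) t)
    (hM : ∀ t ∈ Set.Icc a b, |g₃ t| ≤ M) :
    |G b - G a - (b - a) / 2 * (g a + g b) + (b - a) ^ 2 / 12 * (g₁ b - g₁ a)| ≤
      M / 72 * (b - a) ^ 4 := by
  have id' : ∀ t : ℝ, HasDerivAt (fun t => t - a) 1 t := fun t => (hasDerivAt_id t).sub_const a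
  -- The error, as a function of the right endpoint t, is the φ of `r3`; its derivative is the φ of
  -- `r2`, whose derivative is one sixth of the φ of `r1` plus a g₃ term. Integrating upwards, the
  -- constants are M/2, then (M/12 + M/12)/3 = M/18, then M/72.
  have r1 := abs_le_of_abs_deriv_le_pow (a := a) (b := b) (C := M) 1
    (φ := fun t => g₁ t - g₁ a - (t - a) * g₂ t) (φ' := fun t => -((t - a) * g₃ t)) (by simp)
    (fun t ht => by
      refine (((h2 t ht).sub_const _).sub ((id' t).mul (h3 t ht))).congr_deriv ?_
      ring)
    (fun t ht => by
      rw [abs_neg, abs_mul, abs_of_nonneg (by linarith [ht.1]), pow_one, mul_comm]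
      exact mul_le_mul_of_nonneg_right (hM t ht) (by linarith [ht.1]))
  have r2 := abs_le_of_abs_deriv_le_pow (a := a) (b := b) (C := M / 6) 2
    (φ := fun t => g t / 2 - g a / 2 - (t - a) / 2 * g₁ t + (t - a) / 6 * (g₁ t - g₁ a) +
      (t - a) ^ 2 / 12 * g₂ t)
    (φ' := fun t => (g₁ t - g₁ a - (t - a) * g₂ t) / 6 + (t - a) ^ 2 / 12 * g₃ t) (by simp)
    (fun t ht => by
      refine (((((h1 t ht).div_const 2).sub_const (g a / 2)).sub
        (((id' t).div_const 2).mul (h2 t ht))).add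
        (((id' t).div_const 6).mul ((h2 t ht).sub_const (g₁ a)))).add
        ((((id' t).pow 2).div_const 12).mul (h3 t ht)) |>.congr_deriv ?_
      simp
      ring)
    (fun t ht => by
      have e1 := r1 t ht
      have e2 : |(t - a) ^ 2 / 12 * g₃ t| ≤ (t - a) ^ 2 / 12 * M := by
        rw [abs_mul, abs_of_nonneg (by positivity)]
        exact mul_le_mul_of_nonneg_left (hM t ht) (by positivity)
      refine (abs_add_le _ _).trans ?_
      rw [abs_div, abs_of_pos (by norm_num : (0 : ℝ) < 6)]
      norm_num at e1
      linarith)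
  have r3 := abs_le_of_abs_deriv_le_pow (a := a) (b := b) (C := M / 18) 3
    (φ := fun t => G t - G a - (t - a) / 2 * (g a + g t) + (t - a) ^ 2 / 12 * (g₁ t - g₁ a))
    (φ' := fun t => g t / 2 - g a / 2 - (t - a) / 2 * g₁ t + (t - a) / 6 * (g₁ t - g₁ a) +
      (t - a) ^ 2 / 12 * g₂ t) (by simp)
    (fun t ht => by
      refine (((hG t ht).sub_const (G a)).sub (((id' t).div_const 2).mul
        ((h1 t ht).const_add (g a)))).add
        ((((id' t).pow 2).div_const 12).mul ((h2 t ht).sub_const (g₁ a))) |>.congr_deriv ?_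
      simp
      ring)
    (fun t ht => (r2 t ht).trans (le_of_eq (by push_cast; ring)))
  refine (r3 b ⟨hab, le_rfl⟩).trans (le_of_eq (by push_cast; ring))

/-- Passes from trapezoidal sums, where neighbouring values are averaged, to a plain sum. -/
theorem sum_Icc_eq_sum_range_half (u : ℕ → ℝ) (h0 : u 0 = 0) (n : ℕ) :
    2 * ∑ k ∈ Finset.Icc 1 n, u k = ∑ k ∈ Finset.range n, (u k + u (k + 1)) + u n := by
  induction n with
  | zero => simp [h0]
  | succ n ih =>
    rw [Finset.sum_Icc_succ_top (by omega), Finset.sum_range_succ, mul_add, ih]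
    ring

/-- Euler–Maclaurin summation on `[0, 1]` for a function vanishing at both ends. -/
theorem tendsto_mul_sum_sub_sq_mul_integral {G g g₁ g₂ g₃ : ℝ → ℝ} {M : ℝ}
    (hG : ∀ t ∈ Set.Icc (0 : ℝ) 1, HasDerivAt G (g t) t)
    (h1 : ∀ t ∈ Set.Icc (0 : ℝ) 1, HasDerivAt g (g₁ t) t)
    (h2 : ∀ t ∈ Set.Icc (0 : ℝ) 1, HasDerivAt g₁ (g₂ t) t)
    (h3 : ∀ t ∈ Set.Icc (0 : ℝ) 1, HasDerivAt g₂ (g₃ t) t)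
    (hM : ∀ t ∈ Set.Icc (0 : ℝ) 1, |g₃ t| ≤ M) (hg0 : g 0 = 0) (hg1 : g 1 = 0) :
    Filter.Tendsto (fun n : ℕ => (n : ℝ) * ∑ k ∈ Finset.Icc 1 (n - 1), g ((k : ℝ) / n) -
      (n : ℝ) ^ 2 * (G 1 - G 0)) Filter.atTop (nhds ((g₁ 1 - g₁ 0) / 12)) := by
  -- Each of the n cells contributes at most (M/72) n⁻⁴, and the total is scaled by n². The G and g₁
  -- terms telescope.
  have key : ∀ n : ℕ, 1 ≤ n → |((n : ℝ) * ∑ k ∈ Finset.Icc 1 (n - 1), g ((k : ℝ) / n) -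
      (n : ℝ) ^ 2 * (G 1 - G 0)) - (g₁ 1 - g₁ 0) / 12| ≤ M / 72 * (1 / (n : ℝ)) := by
    intro n hn
    have n0 : (0 : ℝ) < n := by exact_mod_cast hn
    have step : ∀ k ∈ Finset.range n,
        |G (((k + 1 : ℕ) : ℝ) / n) - G ((k : ℝ) / n) -
          (1 / (n : ℝ)) / 2 * (g ((k : ℝ) / n) + g (((k + 1 : ℕ) : ℝ) / n)) +
          (1 / (n : ℝ)) ^ 2 / 12 * (g₁ (((k + 1 : ℕ) : ℝ) / n) - g₁ ((k : ℝ) / n))| ≤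
        M / 72 * (1 / (n : ℝ)) ^ 4 := by
      intro k hk
      have hk' : ((k + 1 : ℕ) : ℝ) ≤ n := by exact_mod_cast Finset.mem_range.mp hk
      have hd : ((k + 1 : ℕ) : ℝ) / n - (k : ℝ) / n = 1 / n := by push_cast; field_simp; ring
      have hsub : Set.Icc ((k : ℝ) / n) (((k + 1 : ℕ) : ℝ) / n) ⊆ Set.Icc 0 1 :=
        Set.Icc_subset_Icc (by positivity) ((div_le_one n0).mpr hk')
      have := abs_integral_sub_trapezoid_add_le (a := (k : ℝ) / n) (b := ((k + 1 : ℕ) : ℝ) / n)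
        (by have : 0 < 1 / (n : ℝ) := by positivity
            linarith)
        (fun t ht => hG t (hsub ht)) (fun t ht => h1 t (hsub ht)) (fun t ht => h2 t (hsub ht))
        (fun t ht => h3 t (hsub ht)) (fun t ht => hM t (hsub ht))
      rwa [hd] at this
    have tot := (Finset.abs_sum_le_sum_abs _ _).trans (Finset.sum_le_sum step)
    rw [Finset.sum_const, Finset.card_range, nsmul_eq_mul, Finset.sum_add_distrib,
      Finset.sum_sub_distrib, ← Finset.mul_sum, ← Finset.mul_sum,
      Finset.sum_range_sub (fun k : ℕ => G ((k : ℝ) / n)),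
      Finset.sum_range_sub (fun k : ℕ => g₁ ((k : ℝ) / n))] at tot
    have hs := sum_Icc_eq_sum_range_half (fun k : ℕ => g ((k : ℝ) / n)) (by simp [hg0]) n
    have hlast : ∑ k ∈ Finset.Icc 1 n, g ((k : ℝ) / n) =
        ∑ k ∈ Finset.Icc 1 (n - 1), g ((k : ℝ) / n) := by
      obtain ⟨m, rfl⟩ : ∃ m, n = m + 1 := ⟨n - 1, by omega⟩
      rw [Finset.sum_Icc_succ_top (by omega), div_self n0.ne', hg1, add_zero, Nat.add_sub_cancel]
    simp only [hlast, div_self n0.ne', hg1, add_zero] at hs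
    rw [← hs] at tot
    simp only [div_self n0.ne', Nat.cast_zero, zero_div] at tot
    have : ((n : ℝ) * ∑ k ∈ Finset.Icc 1 (n - 1), g ((k : ℝ) / n) -
      (n : ℝ) ^ 2 * (G 1 - G 0)) - (g₁ 1 - g₁ 0) / 12 = -((n : ℝ) ^ 2 * (G 1 - G 0 - 1 / (n : ℝ) / 2 *
        (2 * ∑ k ∈ Finset.Icc 1 (n - 1), g ((k : ℝ) / n)) +
        (1 / (n : ℝ)) ^ 2 / 12 * (g₁ 1 - g₁ 0))) := by
      field_simp
      ring
    rw [this, abs_neg, abs_mul, abs_of_pos (by positivity)]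
    refine (mul_le_mul_of_nonneg_left tot (by positivity)).trans (le_of_eq ?_)
    field_simp
  rw [tendsto_iff_norm_sub_tendsto_zero]
  have hz : Filter.Tendsto (fun n : ℕ => M / 72 * (1 / (n : ℝ))) Filter.atTop (nhds 0) := by
    simpa using tendsto_one_div_atTop_nhds_zero_nat.const_mul (M / 72)
  refine squeeze_zero' (Filter.Eventually.of_forall fun n => norm_nonneg _) ?_ hz
  filter_upwards [Filter.eventually_ge_atTop 1] with n hn
  exact key n hn

/-! ### Rational bounds for log(1 + 1/a). -/

/-- The series is 2 artanh(1/(2a + 1)); all its terms are positive. -/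
theorem sum_le_log_one_add_inv {a : ℝ} (ha : 0 < a) (K : ℕ) :
    ∑ k ∈ Finset.range K, 2 * (1 / (2 * (k : ℝ) + 1)) * (1 / (2 * a + 1)) ^ (2 * k + 1) ≤
      Real.log (1 + a⁻¹) :=
  sum_le_hasSum _ (fun k _ => by positivity) (Real.hasSum_log_one_add_inv ha)

/-- With x = 1/(2a + 1), the tail is dominated by a geometric series of ratio x² once every
coefficient is replaced by the first, 1/(2K + 1). The last factor is 2x/(1 - x²). -/
theorem log_one_add_inv_le_sum_add {a : ℝ} (ha : 0 < a) (K : ℕ) :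
    Real.log (1 + a⁻¹) ≤
      ∑ k ∈ Finset.range K, 2 * (1 / (2 * (k : ℝ) + 1)) * (1 / (2 * a + 1)) ^ (2 * k + 1) +
        (1 / (2 * (K : ℝ) + 1)) * (1 / (2 * a + 1)) ^ (2 * K) *
          ((2 * a + 1) / (2 * (a * (a + 1)))) := by
  have hs := (hasSum_nat_add_iff' K).mpr (Real.hasSum_log_one_add_inv ha)
  obtain ⟨x, hx⟩ : ∃ x : ℝ, x = 1 / (2 * a + 1) := ⟨_, rfl⟩
  rw [← hx] at hs ⊢
  have hx0 : 0 < x := by rw [hx]; positivity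
  have hx1 : x < 1 := by rw [hx, div_lt_one (by positivity)]; linarith
  have hg := (hasSum_geometric_of_lt_one (sq_nonneg x) (by nlinarith)).mul_left
    (2 * (1 / (2 * (K : ℝ) + 1)) * x ^ (2 * K + 1))
  have hle := hasSum_le (fun k => ?_) hs hg
  · have hi : x * (1 - x ^ 2)⁻¹ = (2 * a + 1) / (4 * (a * (a + 1))) := by
      have h1 : 1 - x ^ 2 = 4 * (a * (a + 1)) / (2 * a + 1) ^ 2 := by
        rw [hx]; field_simp; ring
      rw [h1, hx]
      field_simp
    have : 2 * (1 / (2 * (K : ℝ) + 1)) * x ^ (2 * K + 1) * (1 - x ^ 2)⁻¹ =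
        (1 / (2 * (K : ℝ) + 1)) * x ^ (2 * K) * ((2 * a + 1) / (2 * (a * (a + 1)))) := by
      rw [pow_succ, show ∀ c y : ℝ, 2 * c * (y * x) * (1 - x ^ 2)⁻¹ =
        c * y * (2 * (x * (1 - x ^ 2)⁻¹)) from fun c y => by ring, hi]
      field_simp
      ring
    rw [this] at hle
    linarith
  · have e : x ^ (2 * (k + K) + 1) = x ^ (2 * K + 1) * (x ^ 2) ^ k := by ring
    rw [e, ← mul_assoc]
    gcongr
    linarith [k.cast_nonneg (α := ℝ)]

/-- From log(1 + 1/n) = 1/n - 1/(2n²) + O(n⁻³). This is the source of the -1/4 in ∫₀¹ x log Γ(1 + x)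
dx. -/
theorem tendsto_sq_sub_one_mul_log :
    Filter.Tendsto (fun n : ℕ => ((n : ℝ) ^ 2 - 1) / 2 * Real.log (1 + (n : ℝ)⁻¹) - n / 2)
      Filter.atTop (nhds (-(1 / 4))) := by
  rw [tendsto_iff_norm_sub_tendsto_zero]
  refine squeeze_zero' (Filter.Eventually.of_forall fun n => norm_nonneg _) ?_
    tendsto_one_div_atTop_nhds_zero_nat
  filter_upwards [Filter.eventually_ge_atTop 1] with n hn
  have h1 : (1 : ℝ) ≤ n := by exact_mod_cast hn
  have h0 : (0 : ℝ) < n := by linarith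
  have hl := sum_le_log_one_add_inv h0 1
  have hu := log_one_add_inv_le_sum_add h0 1
  norm_num at hl hu
  set S := Real.log (1 + (n : ℝ)⁻¹)
  have hc : 0 ≤ ((n : ℝ) ^ 2 - 1) / 2 := by nlinarith
  have m1 := mul_le_mul_of_nonneg_left hl hc
  have m2 := mul_le_mul_of_nonneg_left hu hc
  have e1 : ((n : ℝ) ^ 2 - 1) / 2 * (2 * (2 * (n : ℝ) + 1)⁻¹) - n / 2 + 1 / 4 =
      - (3 / (4 * (2 * n + 1))) := by
    field_simp
    ring
  have e2 : 3 / (4 * (2 * (n : ℝ) + 1)) ≤ 1 / n := by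
    rw [div_le_div_iff₀ (by positivity) h0]
    linarith
  have e3 : ((n : ℝ) ^ 2 - 1) / 2 * (1 / 3 * ((2 * (n : ℝ) + 1) ^ 2)⁻¹ *
      ((2 * (n : ℝ) + 1) / (2 * ((n : ℝ) * (n + 1))))) ≤ 1 / n := by
    have : ((n : ℝ) ^ 2 - 1) / 2 * (1 / 3 * ((2 * (n : ℝ) + 1) ^ 2)⁻¹ *
      ((2 * (n : ℝ) + 1) / (2 * ((n : ℝ) * (n + 1))))) = (n - 1) / (12 * (2 * n + 1)) / n := by
      field_simp
      ring
    rw [this]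
    gcongr
    rw [div_le_one (by positivity)]
    linarith
  have e4 : 0 < 3 / (4 * (2 * (n : ℝ) + 1)) := by positivity
  rw [mul_add] at m2
  rw [Real.norm_eq_abs, abs_le]
  constructor <;> linarith

/-! ### Regularity and endpoint data of x log Γ(1 + x). -/

/-- The function `x ↦ x log Γ(1 + x)`. -/
noncomputable def mulLogGamma (x : ℝ) : ℝ := x * Real.log (Real.Gamma (1 + x))

/-- Restriction to the real line of a function holomorphic on the right half-plane. Analyticity
supplies all the derivatives that Euler–Maclaurin needs, without polygamma formulas. -/
theorem analyticAt_Gamma_of_pos {x : ℝ} (hx : 0 < x) : AnalyticAt ℝ Real.Gamma x := by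
  have hU : IsOpen {z : ℂ | 0 < z.re} := isOpen_lt continuous_const Complex.continuous_re
  have hd : DifferentiableOn ℂ Complex.Gamma {z : ℂ | 0 < z.re} := fun z hz =>
    (Complex.differentiableAt_Gamma z fun m h => by
      have hz' : 0 < z.re := hz
      rw [h] at hz'
      simp at hz'
      linarith [m.cast_nonneg (α := ℝ)]).differentiableWithinAt
  have ha : AnalyticAt ℂ Complex.Gamma (x : ℂ) := hd.analyticAt (hU.mem_nhds (by simpa using hx))
  refine ha.re_ofReal.congr (Filter.Eventually.of_forall fun y => ?_)
  simp [Complex.Gamma_ofReal]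

theorem analyticOnNhd_mulLogGamma : AnalyticOnNhd ℝ mulLogGamma (Set.Ioi (-1)) := by
  intro x hx
  have hx' : 0 < 1 + x := by have : -1 < x := hx; linarith
  have h := (analyticAt_Gamma_of_pos hx').fun_comp (g := Real.Gamma) (f := fun y : ℝ => 1 + y)
    (analyticAt_const.add analyticAt_id)
  exact analyticAt_id.mul (h.log (Real.Gamma_pos_of_pos hx'))

theorem mulLogGamma_zero : mulLogGamma 0 = 0 := by simp [mulLogGamma]

theorem mulLogGamma_one : mulLogGamma 1 = 0 := by
  simp [mulLogGamma, one_add_one_eq_two]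

theorem hasDerivAt_mulLogGamma {x : ℝ} {c : ℝ} (hx : 0 < 1 + x)
    (h : HasDerivAt Real.Gamma c (1 + x)) :
    HasDerivAt mulLogGamma (Real.log (Real.Gamma (1 + x)) + x * (c / Real.Gamma (1 + x))) x := by
  have h1 := (HasDerivAt.comp_const_add 1 x h).log (Real.Gamma_pos_of_pos hx).ne'
  refine ((hasDerivAt_id x).mul h1).congr_deriv ?_
  simp

theorem deriv_mulLogGamma_zero : deriv mulLogGamma 0 = 0 := by
  have := (hasDerivAt_mulLogGamma (x := 0) (by norm_num)
    (by simpa using Real.hasDerivAt_Gamma_one)).deriv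
  simpa using this

/-- As Γ(2) = 1, the logarithm vanishes and only Γ'(2) = 1 - γ survives. -/
theorem deriv_mulLogGamma_one : deriv mulLogGamma 1 = 1 - Real.eulerMascheroniConstant := by
  have h := Real.hasDerivAt_Gamma_nat 1
  have := (hasDerivAt_mulLogGamma (x := 1) (by norm_num)
    (by simpa [one_add_one_eq_two] using h)).deriv
  rw [this]
  norm_num
  ring

theorem exists_primitive_mulLogGamma :
    ∃ G : ℝ → ℝ, ∀ t ∈ Set.Icc (0 : ℝ) 1, HasDerivAt G (mulLogGamma t) t := by
  refine ⟨fun u => ∫ x in (0 : ℝ)..u, mulLogGamma x, fun t ht => ?_⟩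
  have hc : ContinuousOn mulLogGamma (Set.Ioi (-1)) := analyticOnNhd_mulLogGamma.continuousOn
  have ht' : t ∈ Set.Ioi (-1 : ℝ) := by have := ht.1; simp; linarith
  refine intervalIntegral.integral_hasDerivAt_right ?_ ?_
    (hc.continuousAt (isOpen_Ioi.mem_nhds ht'))
  · refine (hc.mono fun y hy => ?_).intervalIntegrable
    rw [Set.uIcc_of_le ht.1] at hy
    have := hy.1
    simp
    linarith
  · exact hc.stronglyMeasurableAtFilter isOpen_Ioi t ht'

theorem tendsto_sum_mulLogGamma {G : ℝ → ℝ}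
    (hG : ∀ t ∈ Set.Icc (0 : ℝ) 1, HasDerivAt G (mulLogGamma t) t) :
    Filter.Tendsto (fun n : ℕ => (n : ℝ) * ∑ k ∈ Finset.Icc 1 (n - 1), mulLogGamma ((k : ℝ) / n) -
      (n : ℝ) ^ 2 * (G 1 - G 0)) Filter.atTop
      (nhds ((1 - Real.eulerMascheroniConstant) / 12)) := by
  have hsub : Set.Icc (0 : ℝ) 1 ⊆ Set.Ioi (-1) := fun y hy => by
    have := hy.1
    simp
    linarith
  have a0 := analyticOnNhd_mulLogGamma
  have a1 := a0.deriv
  have a2 := a1.deriv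
  have a3 := a2.deriv
  obtain ⟨M, hM⟩ := isCompact_Icc.exists_bound_of_continuousOn (a3.continuousOn.mono hsub)
  have := tendsto_mul_sum_sub_sq_mul_integral hG
    (fun t ht => (a0 t (hsub ht)).differentiableAt.hasDerivAt)
    (fun t ht => (a1 t (hsub ht)).differentiableAt.hasDerivAt)
    (fun t ht => (a2 t (hsub ht)).differentiableAt.hasDerivAt) hM mulLogGamma_zero mulLogGamma_one
  rwa [deriv_mulLogGamma_zero, deriv_mulLogGamma_one, sub_zero] at this

/-! ### The integral of x log Γ(1 + x) over [0, 1]. -/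

/-- A primitive of `x ↦ x (log (x Γₙ(x)))`, with `Γₙ` Euler's `n`-th approximation of `Γ`. -/
noncomputable def gammaSeqPrimitive (n : ℕ) (x : ℝ) : ℝ :=
  x ^ 3 / 3 * Real.log n + x ^ 2 / 2 * Real.log n.factorial -
    ∑ m ∈ Finset.range n, ((x ^ 2 - (m + 1) ^ 2) / 2 * Real.log (x + (m + 1)) - x ^ 2 / 4 +
      (m + 1) * x / 2)

theorem hasDerivAt_gammaSeqPrimitive (n : ℕ) {x : ℝ} (hx : 0 < x) :
    HasDerivAt (gammaSeqPrimitive n)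
      (x * (Real.BohrMollerup.logGammaSeq x n + Real.log x)) x := by
  have hid := hasDerivAt_id x
  have h1 := ((hid.pow 3).div_const 3).mul_const (Real.log n)
  have h2 := ((hid.pow 2).div_const 2).mul_const (Real.log n.factorial)
  have h3 := HasDerivAt.fun_sum (u := Finset.range n)
    (A := fun (m : ℕ) (y : ℝ) => (y ^ 2 - ((m : ℝ) + 1) ^ 2) / 2 * Real.log (y + (m + 1)) -
      y ^ 2 / 4 + (m + 1) * y / 2) (A' := fun m => x * Real.log (x + ((m : ℝ) + 1))) (x := x)
    (fun m _ => by
      have hm : 0 < x + ((m : ℝ) + 1) := by positivity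
      have hl := (hid.add_const ((m : ℝ) + 1)).log hm.ne'
      refine ((((((hid.pow 2).sub_const (((m : ℝ) + 1) ^ 2)).div_const 2).mul hl).sub
        ((hid.pow 2).div_const 4)).add ((hid.const_mul ((m : ℝ) + 1)).div_const 2)).congr_deriv ?_
      simp
      field_simp
      ring)
  refine ((h1.add h2).sub h3).congr_deriv ?_
  -- The m = 0 term of `logGammaSeq` is log x; split off, it cancels the added log x, so nothing
  -- singular at 0 remains.
  rw [Real.BohrMollerup.logGammaSeq, Finset.sum_range_succ', ← Finset.mul_sum]
  simp
  ring

/-- Each log j occurs in two consecutive summands, with coefficients j²/2 and (1 - (j - 1)²)/2,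
which add up to j. -/
theorem sum_primitive_eq (n : ℕ) :
    ∑ m ∈ Finset.range n, ((1 - ((m : ℝ) + 1) ^ 2) / 2 * Real.log (1 + (m + 1)) +
        ((m : ℝ) + 1) ^ 2 / 2 * Real.log (m + 1) - 1 / 4 + (m + 1) / 2) =
      ∑ j ∈ Finset.Icc 1 n, (j : ℝ) * Real.log j + (1 - (n : ℝ) ^ 2) / 2 * Real.log (1 + n) +
        (n : ℝ) ^ 2 / 4 := by
  induction n with
  | zero => simp
  | succ n ih =>
    rw [Finset.sum_range_succ, ih, Finset.sum_Icc_succ_top (by omega)]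
    push_cast
    rw [add_comm (1 : ℝ) n]
    ring

theorem log_glaisherKinkelinSeq {n : ℕ} (hn : 1 ≤ n) :
    Real.log (glaisherKinkelinSeq n) = ∑ j ∈ Finset.Icc 1 n, (j : ℝ) * Real.log j -
      ((n : ℝ) * (n + 1) / 2 + 1 / 12) * Real.log n + (n : ℝ) ^ 2 / 4 := by
  have h0 : (0 : ℝ) < n := by exact_mod_cast hn
  have hP : ∀ ν ∈ Finset.Icc 1 n, (ν : ℝ) ^ ν ≠ 0 := fun ν hν => by
    have : (0 : ℝ) < ν := by exact_mod_cast (Finset.mem_Icc.mp hν).1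
    positivity
  rw [glaisherKinkelinSeq, Real.log_div (Finset.prod_ne_zero_iff.mpr hP) (by positivity),
    Real.log_mul (by positivity) (by positivity), Real.log_exp, Real.log_rpow h0,
    Real.log_prod hP]
  simp only [Real.log_pow]
  ring

theorem gammaSeqPrimitive_one_sub_zero {n : ℕ} (hn : 1 ≤ n) :
    gammaSeqPrimitive n 1 - gammaSeqPrimitive n 0 =
      Real.log (Stirling.stirlingSeq n) / 2 + Real.log 2 / 4 - Real.log (glaisherKinkelinSeq n) +
        (((n : ℝ) ^ 2 - 1) / 2 * Real.log (1 + (n : ℝ)⁻¹) - n / 2) := by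
  have h0 : (0 : ℝ) < n := by exact_mod_cast hn
  have e : gammaSeqPrimitive n 1 - gammaSeqPrimitive n 0 =
      1 / 3 * Real.log n + 1 / 2 * Real.log n.factorial -
      ∑ m ∈ Finset.range n, ((1 - ((m : ℝ) + 1) ^ 2) / 2 * Real.log (1 + (m + 1)) +
        ((m : ℝ) + 1) ^ 2 / 2 * Real.log (m + 1) - 1 / 4 + (m + 1) / 2) := by
    have hs : ∀ m : ℕ, (1 - ((m : ℝ) + 1) ^ 2) / 2 * Real.log (1 + (m + 1)) +
        ((m : ℝ) + 1) ^ 2 / 2 * Real.log (m + 1) - 1 / 4 + (m + 1) / 2 =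
        ((1 ^ 2 - ((m : ℝ) + 1) ^ 2) / 2 * Real.log (1 + (m + 1)) - 1 ^ 2 / 4 +
          (m + 1) * 1 / 2) -
        ((0 ^ 2 - ((m : ℝ) + 1) ^ 2) / 2 * Real.log (0 + (m + 1)) - 0 ^ 2 / 4 +
          (m + 1) * 0 / 2) := fun m => by rw [zero_add]; ring
    simp only [hs, Finset.sum_sub_distrib, gammaSeqPrimitive]
    ring
  have hl : Real.log (1 + (n : ℝ)⁻¹) = Real.log (1 + n) - Real.log n := by
    rw [← Real.log_div (by positivity) h0.ne']
    congr 1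
    field_simp
    ring
  rw [e, sum_primitive_eq, log_glaisherKinkelinSeq hn, Stirling.log_stirlingSeq_formula, hl,
    Real.log_div h0.ne' (Real.exp_pos 1).ne', Real.log_exp, Real.log_mul two_ne_zero h0.ne']
  ring

/-- The mean value theorem for the difference of the two primitives yields c in (0, 1) where the
left side is c (log Γ(c) - log Γₙ(c)); the Bohr–Mollerup inequalities, from log-convexity of Γ,
bound this. No limit has to be exchanged with an integral. -/
theorem abs_primitive_sub_le {G : ℝ → ℝ}
    (hG : ∀ t ∈ Set.Icc (0 : ℝ) 1, HasDerivAt G (mulLogGamma t) t) {n : ℕ} (hn : 1 ≤ n) :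
    |(G 1 - G 0) - (gammaSeqPrimitive n 1 - gammaSeqPrimitive n 0)| ≤
      Real.log (n + 1) - Real.log n := by
  have h0 : (0 : ℝ) < n := by exact_mod_cast hn
  have hcont : ContinuousOn (gammaSeqPrimitive n) (Set.Icc 0 1) := by
    unfold gammaSeqPrimitive
    refine (by fun_prop : Continuous fun x : ℝ => x ^ 3 / 3 * Real.log n +
      x ^ 2 / 2 * Real.log n.factorial).continuousOn.sub (continuousOn_finsetSum _ fun m _ => ?_)
    have hm : ∀ x ∈ Set.Icc (0 : ℝ) 1, x + ((m : ℝ) + 1) ≠ 0 := fun x hx => by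
      have := hx.1
      positivity
    exact ((ContinuousOn.mul (by fun_prop) (ContinuousOn.log (by fun_prop) hm)).sub
      (by fun_prop)).add (by fun_prop)
  obtain ⟨c, hc, hc'⟩ := exists_hasDerivAt_eq_slope (fun x => G x - gammaSeqPrimitive n x)
    (fun x => mulLogGamma x - x * (Real.BohrMollerup.logGammaSeq x n + Real.log x))
    zero_lt_one (ContinuousOn.sub (fun t ht => (hG t ht).continuousAt.continuousWithinAt)
      hcont)
    (fun x hx => (hG x (Set.Ioo_subset_Icc_self hx)).sub (hasDerivAt_gammaSeqPrimitive n hx.1))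
  have hfeq : ∀ {y : ℝ}, 0 < y →
      (Real.log ∘ Real.Gamma) (y + 1) = (Real.log ∘ Real.Gamma) y + Real.log y := fun {y} hy => by
    rw [Function.comp_apply, Real.Gamma_add_one hy.ne',
      Real.log_mul hy.ne' (Real.Gamma_pos_of_pos hy).ne', add_comm, Function.comp_apply]
  have up := Real.BohrMollerup.le_logGammaSeq Real.convexOn_log_Gamma hfeq hc.1 hc.2.le n
  have lo := Real.BohrMollerup.ge_logGammaSeq Real.convexOn_log_Gamma hfeq hc.1
    (Nat.one_le_iff_ne_zero.mp hn)
  have hf := hfeq hc.1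
  simp only [Function.comp_apply, Real.Gamma_one, Real.log_one, zero_add] at up lo hf
  have e : (G 1 - G 0) - (gammaSeqPrimitive n 1 - gammaSeqPrimitive n 0) =
      c * (Real.log (Real.Gamma c) - Real.BohrMollerup.logGammaSeq c n) := by
    have : (G 1 - G 0) - (gammaSeqPrimitive n 1 - gammaSeqPrimitive n 0) =
        mulLogGamma c - c * (Real.BohrMollerup.logGammaSeq c n + Real.log c) := by
      rw [hc']
      ring
    rw [this, mulLogGamma, add_comm 1 c, hf]
    ring
  have hmono : 0 ≤ Real.log ((n : ℝ) + 1) - Real.log n :=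
    sub_nonneg.mpr (Real.log_le_log h0 (by linarith))
  rw [e, abs_of_nonneg (mul_nonneg hc.1.le (by linarith))]
  have b1 : Real.log (Real.Gamma c) - Real.BohrMollerup.logGammaSeq c n ≤
      c * (Real.log ((n : ℝ) + 1) - Real.log n) := by linarith
  have b2 : c * (Real.log ((n : ℝ) + 1) - Real.log n) ≤ Real.log ((n : ℝ) + 1) - Real.log n :=
    mul_le_of_le_one_left hmono hc.2.le
  exact (mul_le_of_le_one_left (by linarith) hc.2.le).trans (b1.trans b2)

theorem tendsto_log_glaisherKinkelinSeq :
    Filter.Tendsto (fun n => Real.log (glaisherKinkelinSeq n)) Filter.atTop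
      (nhds (Real.log glaisherKinkelin)) :=
  (Real.continuousAt_log glaisherKinkelin_pos.ne').tendsto.comp tendsto_glaisherKinkelinSeq

/-- The value of `∫₀¹ x log Γ(1 + x) dx`. -/
theorem primitive_mulLogGamma_one_sub_zero {G : ℝ → ℝ}
    (hG : ∀ t ∈ Set.Icc (0 : ℝ) 1, HasDerivAt G (mulLogGamma t) t) :
    G 1 - G 0 = Real.log (2 * Real.pi) / 4 - Real.log glaisherKinkelin - 1 / 4 := by
  have hst : Filter.Tendsto (fun n => Real.log (Stirling.stirlingSeq n)) Filter.atTop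
      (nhds (Real.log √Real.pi)) :=
    (Real.continuousAt_log (by positivity)).tendsto.comp Stirling.tendsto_stirlingSeq_sqrt_pi
  have lim1 := (((hst.div_const 2).add_const (Real.log 2 / 4)).sub
    tendsto_log_glaisherKinkelinSeq).add tendsto_sq_sub_one_mul_log
  have lim2 : Filter.Tendsto (fun n => gammaSeqPrimitive n 1 - gammaSeqPrimitive n 0) Filter.atTop
      (nhds (G 1 - G 0)) := by
    rw [tendsto_iff_norm_sub_tendsto_zero]
    refine squeeze_zero' (Filter.Eventually.of_forall fun n => norm_nonneg _) ?_
      Real.tendsto_log_nat_add_one_sub_log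
    filter_upwards [Filter.eventually_ge_atTop 1] with n hn
    rw [norm_sub_rev]
    exact abs_primitive_sub_le hG hn
  have := tendsto_nhds_unique lim2 (lim1.congr' (by
    filter_upwards [Filter.eventually_ge_atTop 1] with n hn
    exact (gammaSeqPrimitive_one_sub_zero hn).symm))
  rw [this, Real.log_sqrt Real.pi_pos.le, Real.log_mul two_ne_zero Real.pi_ne_zero]
  ring

/-! ### Asymptotics of the product. -/

theorem log_prod_Gamma_pow {n : ℕ} (hn : 1 ≤ n) :
    Real.log (∏ ν ∈ Finset.Icc 1 (n - 1), Real.Gamma ((ν : ℝ) / (n : ℝ)) ^ ν) =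
      (n : ℝ) * ∑ k ∈ Finset.Icc 1 (n - 1), mulLogGamma ((k : ℝ) / n) -
        Real.log (glaisherKinkelinSeq n) - Real.log n / 12 + (n : ℝ) ^ 2 / 4 := by
  have h0 : (0 : ℝ) < n := by exact_mod_cast hn
  have hpos : ∀ ν ∈ Finset.Icc 1 (n - 1), (0 : ℝ) < (ν : ℝ) / n := fun ν hν => by
    have : (0 : ℝ) < ν := by exact_mod_cast (Finset.mem_Icc.mp hν).1
    positivity
  have hterm : ∀ ν ∈ Finset.Icc 1 (n - 1),
      Real.log (Real.Gamma ((ν : ℝ) / (n : ℝ)) ^ ν) =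
        n * mulLogGamma ((ν : ℝ) / n) - ν * Real.log ν + ν * Real.log n := fun ν hν => by
    have hp := hpos ν hν
    have hν0 : (0 : ℝ) < ν := by exact_mod_cast (Finset.mem_Icc.mp hν).1
    rw [Real.log_pow, mulLogGamma, add_comm 1, Real.Gamma_add_one hp.ne',
      Real.log_mul hp.ne' (Real.Gamma_pos_of_pos hp).ne', Real.log_div hν0.ne' h0.ne']
    field_simp
    ring
  rw [Real.log_prod fun ν hν => (pow_pos (Real.Gamma_pos_of_pos (hpos ν hν)) ν).ne',
    Finset.sum_congr rfl hterm, Finset.sum_add_distrib, Finset.sum_sub_distrib, ← Finset.mul_sum,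
    ← Finset.sum_mul, log_glaisherKinkelinSeq hn]
  -- The product stops at n - 1 but the sequence for A at n: the extra n log n turns n(n - 1)/2 into
  -- the exponent n(n + 1)/2.
  obtain ⟨m, rfl⟩ : ∃ m, n = m + 1 := ⟨n - 1, by omega⟩
  have hid : ∀ m : ℕ, ∑ ν ∈ Finset.Icc 1 m, (ν : ℝ) = m * (m + 1) / 2 := fun m => by
    induction m with
    | zero => simp
    | succ m ih => rw [Finset.sum_Icc_succ_top (by omega), ih]; push_cast; ring
  rw [Nat.add_sub_cancel, hid, Finset.sum_Icc_succ_top (by omega)]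
  push_cast
  ring

theorem tendsto_prod_Gamma_pow_div :
    Filter.Tendsto
      (fun n : ℕ =>
        (∏ ν ∈ Finset.Icc 1 (n - 1), Real.Gamma ((ν : ℝ) / (n : ℝ)) ^ ν) /
          (Real.exp ((1 - Real.eulerMascheroniConstant) / 12) / glaisherKinkelin *
              ((2 * Real.pi) ^ (1 / 4 : ℝ) / glaisherKinkelin) ^ (n ^ 2) /
            (n : ℝ) ^ (1 / 12 : ℝ)))
      Filter.atTop (nhds 1) := by
  obtain ⟨G, hG⟩ := exists_primitive_mulLogGamma
  have hA := glaisherKinkelin_pos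
  have hlim := ((tendsto_sum_mulLogGamma hG).sub tendsto_log_glaisherKinkelinSeq).sub_const
    ((1 - Real.eulerMascheroniConstant) / 12 - Real.log glaisherKinkelin)
  rw [sub_self] at hlim
  have hexp := (Real.continuous_exp.tendsto 0).comp hlim
  rw [Real.exp_zero] at hexp
  refine hexp.congr' ?_
  filter_upwards [Filter.eventually_ge_atTop 1] with n hn
  have h0 : (0 : ℝ) < n := by exact_mod_cast hn
  have hP : 0 < ∏ ν ∈ Finset.Icc 1 (n - 1), Real.Gamma ((ν : ℝ) / (n : ℝ)) ^ ν :=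
    Finset.prod_pos fun ν hν => by
      have : (0 : ℝ) < ν := by exact_mod_cast (Finset.mem_Icc.mp hν).1
      exact pow_pos (Real.Gamma_pos_of_pos (by positivity)) ν
  -- For n ≥ 1 this is an exact identity: the n²/4 from the normalisation of A cancels the -1/4 in
  -- the integral.
  rw [Function.comp_apply, ← Real.exp_log (div_pos hP (by positivity)),
    Real.log_div hP.ne' (by positivity), Real.log_div (by positivity) (by positivity),
    Real.log_mul (by positivity) (by positivity), Real.log_div (by positivity) hA.ne',
    Real.log_exp, Real.log_pow, Real.log_div (by positivity) hA.ne',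
    Real.log_rpow (by positivity), Real.log_rpow h0, log_prod_Gamma_pow hn,
    primitive_mulLogGamma_one_sub_zero hG]
  congr 1
  push_cast
  ring

/-! ### Monotone sequences enclosing log A and γ. -/

/-- The corrections are the first terms B₂ₖ₊₂/(2k(2k + 1)(2k + 2)n²ᵏ) of the asymptotic expansion of
log A minus the logarithm of its defining sequence. Stopping after three terms gives an increasing
sequence, after two a decreasing one. -/
theorem glaisherKinkelinSeq_lower_step {n : ℕ} (hn : 1 ≤ n) :
    Real.log (glaisherKinkelinSeq n) - 1 / (720 * (n : ℝ) ^ 2) + 1 / (5040 * (n : ℝ) ^ 4) -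
        1 / (10080 * (n : ℝ) ^ 6) ≤
      Real.log (glaisherKinkelinSeq (n + 1)) - 1 / (720 * ((n + 1 : ℕ) : ℝ) ^ 2) +
        1 / (5040 * ((n + 1 : ℕ) : ℝ) ^ 4) - 1 / (10080 * ((n + 1 : ℕ) : ℝ) ^ 6) := by
  have hd := log_glaisherKinkelinSeq_sub n hn
  obtain ⟨m, rfl⟩ : ∃ m, n = m + 1 := ⟨n - 1, by omega⟩
  have hu := log_one_add_inv_le_sum_add (a := ((m + 1 : ℕ) : ℝ)) (by positivity) 4
  have hc : 0 ≤ ((m + 1 : ℕ) : ℝ) * (((m + 1 : ℕ) : ℝ) + 1) / 2 + 1 / 12 := by positivity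
  have hm := mul_le_mul_of_nonneg_left hu hc
  have key : (((m + 1 : ℕ) : ℝ) * (((m + 1 : ℕ) : ℝ) + 1) / 2 + 1 / 12) * Real.log (1 + ((m + 1 : ℕ) : ℝ)⁻¹) ≤
      (2 * ((m + 1 : ℕ) : ℝ) + 1) / 4 - 1 / (720 * ((m + 1 + 1 : ℕ) : ℝ) ^ 2) +
        1 / (5040 * ((m + 1 + 1 : ℕ) : ℝ) ^ 4) - 1 / (10080 * ((m + 1 + 1 : ℕ) : ℝ) ^ 6) -
        (- (1 / (720 * ((m + 1 : ℕ) : ℝ) ^ 2)) + 1 / (5040 * ((m + 1 : ℕ) : ℝ) ^ 4) -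
        1 / (10080 * ((m + 1 : ℕ) : ℝ) ^ 6)) := by
    refine hm.trans ?_
    simp only [Finset.sum_range_succ, Finset.sum_range_zero]
    push_cast
    -- Written in m = n - 1 ≥ 0 with denominators cleared, the difference of the two sides has no
    -- negative coefficients, so `positivity` decides it.
    have h0 : (0 : ℝ) ≤ m := m.cast_nonneg
    generalize (m : ℝ) = y at h0
    norm_num
    field_simp
    rw [← sub_nonneg]
    ring_nf
    positivity
  linarith only [key, hd]

theorem glaisherKinkelinSeq_upper_step {n : ℕ} (hn : 1 ≤ n) :
    Real.log (glaisherKinkelinSeq (n + 1)) - 1 / (720 * ((n + 1 : ℕ) : ℝ) ^ 2) +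
        1 / (5040 * ((n + 1 : ℕ) : ℝ) ^ 4) ≤
      Real.log (glaisherKinkelinSeq n) - 1 / (720 * (n : ℝ) ^ 2) + 1 / (5040 * (n : ℝ) ^ 4) := by
  have hd := log_glaisherKinkelinSeq_sub n hn
  obtain ⟨m, rfl⟩ : ∃ m, n = m + 1 := ⟨n - 1, by omega⟩
  have hu := sum_le_log_one_add_inv (a := ((m + 1 : ℕ) : ℝ)) (by positivity) 4
  have hc : 0 ≤ ((m + 1 : ℕ) : ℝ) * (((m + 1 : ℕ) : ℝ) + 1) / 2 + 1 / 12 := by positivity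
  have hm := mul_le_mul_of_nonneg_left hu hc
  have key : (2 * ((m + 1 : ℕ) : ℝ) + 1) / 4 - 1 / (720 * ((m + 1 + 1 : ℕ) : ℝ) ^ 2) +
        1 / (5040 * ((m + 1 + 1 : ℕ) : ℝ) ^ 4) +
        (1 / (720 * ((m + 1 : ℕ) : ℝ) ^ 2) - 1 / (5040 * ((m + 1 : ℕ) : ℝ) ^ 4)) ≤
      (((m + 1 : ℕ) : ℝ) * (((m + 1 : ℕ) : ℝ) + 1) / 2 + 1 / 12) * Real.log (1 + ((m + 1 : ℕ) : ℝ)⁻¹) := by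
    refine le_trans ?_ hm
    simp only [Finset.sum_range_succ, Finset.sum_range_zero]
    push_cast
    have h0 : (0 : ℝ) ≤ m := m.cast_nonneg
    generalize (m : ℝ) = y at h0
    norm_num
    field_simp
    rw [← sub_nonneg]
    ring_nf
    positivity
  linarith only [key, hd]

/-- The same method for the expansion of γ, whose coefficients are B₂ₖ/(2k). -/
theorem harmonic_lower_step {n : ℕ} (hn : 1 ≤ n) :
    (harmonic n : ℝ) - Real.log n - 1 / (2 * (n : ℝ)) + 1 / (12 * (n : ℝ) ^ 2) -
        1 / (120 * (n : ℝ) ^ 4) ≤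
      (harmonic (n + 1) : ℝ) - Real.log ((n + 1 : ℕ) : ℝ) - 1 / (2 * ((n + 1 : ℕ) : ℝ)) +
        1 / (12 * ((n + 1 : ℕ) : ℝ) ^ 2) - 1 / (120 * ((n + 1 : ℕ) : ℝ) ^ 4) := by
  obtain ⟨m, rfl⟩ : ∃ m, n = m + 1 := ⟨n - 1, by omega⟩
  have hm := log_one_add_inv_le_sum_add (a := ((m + 1 : ℕ) : ℝ)) (by positivity) 3
  have hl : Real.log (1 + ((m + 1 : ℕ) : ℝ)⁻¹) =
      Real.log ((m + 1 + 1 : ℕ) : ℝ) - Real.log ((m + 1 : ℕ) : ℝ) := by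
    rw [← Real.log_div (by positivity) (by positivity)]
    congr 1
    push_cast
    field_simp
  have hh : (harmonic (m + 1 + 1) : ℝ) = harmonic (m + 1) + 1 / ((m + 1 + 1 : ℕ) : ℝ) := by
    rw [harmonic_succ (m + 1)]
    push_cast
    ring
  have key : Real.log (1 + ((m + 1 : ℕ) : ℝ)⁻¹) ≤
      1 / ((m + 1 + 1 : ℕ) : ℝ) - 1 / (2 * ((m + 1 + 1 : ℕ) : ℝ)) +
        1 / (12 * ((m + 1 + 1 : ℕ) : ℝ) ^ 2) - 1 / (120 * ((m + 1 + 1 : ℕ) : ℝ) ^ 4) -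
        (- (1 / (2 * ((m + 1 : ℕ) : ℝ))) + 1 / (12 * ((m + 1 : ℕ) : ℝ) ^ 2) -
        1 / (120 * ((m + 1 : ℕ) : ℝ) ^ 4)) := by
    refine hm.trans ?_
    simp only [Finset.sum_range_succ, Finset.sum_range_zero]
    push_cast
    have h0 : (0 : ℝ) ≤ m := m.cast_nonneg
    generalize (m : ℝ) = y at h0
    norm_num
    field_simp
    rw [← sub_nonneg]
    ring_nf
    positivity
  linarith only [key, hl, hh]

theorem harmonic_upper_step {n : ℕ} (hn : 1 ≤ n) :
    (harmonic (n + 1) : ℝ) - Real.log ((n + 1 : ℕ) : ℝ) - 1 / (2 * ((n + 1 : ℕ) : ℝ)) +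
        1 / (12 * ((n + 1 : ℕ) : ℝ) ^ 2) - 1 / (120 * ((n + 1 : ℕ) : ℝ) ^ 4) +
        1 / (252 * ((n + 1 : ℕ) : ℝ) ^ 6) ≤
      (harmonic n : ℝ) - Real.log n - 1 / (2 * (n : ℝ)) + 1 / (12 * (n : ℝ) ^ 2) -
        1 / (120 * (n : ℝ) ^ 4) + 1 / (252 * (n : ℝ) ^ 6) := by
  obtain ⟨m, rfl⟩ : ∃ m, n = m + 1 := ⟨n - 1, by omega⟩
  have hm := sum_le_log_one_add_inv (a := ((m + 1 : ℕ) : ℝ)) (by positivity) 4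
  have hl : Real.log (1 + ((m + 1 : ℕ) : ℝ)⁻¹) =
      Real.log ((m + 1 + 1 : ℕ) : ℝ) - Real.log ((m + 1 : ℕ) : ℝ) := by
    rw [← Real.log_div (by positivity) (by positivity)]
    congr 1
    push_cast
    field_simp
  have hh : (harmonic (m + 1 + 1) : ℝ) = harmonic (m + 1) + 1 / ((m + 1 + 1 : ℕ) : ℝ) := by
    rw [harmonic_succ (m + 1)]
    push_cast
    ring
  have key : 1 / ((m + 1 + 1 : ℕ) : ℝ) - 1 / (2 * ((m + 1 + 1 : ℕ) : ℝ)) +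
        1 / (12 * ((m + 1 + 1 : ℕ) : ℝ) ^ 2) - 1 / (120 * ((m + 1 + 1 : ℕ) : ℝ) ^ 4) +
        1 / (252 * ((m + 1 + 1 : ℕ) : ℝ) ^ 6) + (1 / (2 * ((m + 1 : ℕ) : ℝ)) - 1 / (12 * ((m + 1 : ℕ) : ℝ) ^ 2) +
        1 / (120 * ((m + 1 : ℕ) : ℝ) ^ 4) - 1 / (252 * ((m + 1 : ℕ) : ℝ) ^ 6)) ≤
      Real.log (1 + ((m + 1 : ℕ) : ℝ)⁻¹) := by
    refine le_trans ?_ hm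
    simp only [Finset.sum_range_succ, Finset.sum_range_zero]
    push_cast
    have h0 : (0 : ℝ) ≤ m := m.cast_nonneg
    generalize (m : ℝ) = y at h0
    norm_num
    field_simp
    rw [← sub_nonneg]
    ring_nf
    positivity
  linarith only [key, hl, hh]

/-! ### Enclosures of logarithms of the primes up to 13. -/

theorem log_two_mem_Icc :
    Real.log 2 ∈ Set.Icc (0.69314718055994530941 : ℝ) 0.69314718055994530942 := by
  have hl := sum_le_log_one_add_inv (a := 1) (by norm_num) 21
  have hu := log_one_add_inv_le_sum_add (a := 1) (by norm_num) 21
  simp only [Finset.sum_range_succ, Finset.sum_range_zero] at hl hu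
  rw [show (1 : ℝ) + 1⁻¹ = 2 by norm_num] at hl hu
  generalize Real.log 2 = S at hl hu
  norm_num at hl hu
  constructor <;> linarith

/-- Each further prime is tied to smaller ones by a ratio (a + 1)/a: here 3/2, later 5/4, 8/7, 11/10
and 13/12. Larger a means faster convergence, hence fewer terms. -/
theorem log_three_mem_Icc :
    Real.log 3 ∈ Set.Icc (1.098612288668109691 : ℝ) 1.098612288668109692 := by
  have hl := sum_le_log_one_add_inv (a := 2) (by norm_num) 14
  have hu := log_one_add_inv_le_sum_add (a := 2) (by norm_num) 14
  simp only [Finset.sum_range_succ, Finset.sum_range_zero] at hl hu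
  have e : Real.log 3 = Real.log 2 + Real.log (1 + 2⁻¹) := by
    rw [← Real.log_mul (by norm_num) (by norm_num)]; norm_num
  obtain ⟨two_lo, two_hi⟩ := log_two_mem_Icc
  rw [e]
  generalize Real.log (1 + 2⁻¹) = S at hl hu
  generalize Real.log 2 = two at *
  norm_num at hl hu
  constructor <;> linarith

theorem log_five_mem_Icc :
    Real.log 5 ∈ Set.Icc (1.609437912434100374 : ℝ) 1.609437912434100375 := by
  have hl := sum_le_log_one_add_inv (a := 4) (by norm_num) 10
  have hu := log_one_add_inv_le_sum_add (a := 4) (by norm_num) 10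
  simp only [Finset.sum_range_succ, Finset.sum_range_zero] at hl hu
  have e : Real.log 5 = 2 * Real.log 2 + Real.log (1 + 4⁻¹) := by
    rw [← Real.log_rpow (by norm_num), ← Real.log_mul (by norm_num) (by norm_num)]; norm_num
  obtain ⟨two_lo, two_hi⟩ := log_two_mem_Icc
  rw [e]
  generalize Real.log (1 + 4⁻¹) = S at hl hu
  generalize Real.log 2 = two at *
  norm_num at hl hu
  constructor <;> linarith

theorem log_seven_mem_Icc :
    Real.log 7 ∈ Set.Icc (1.945910149055313305 : ℝ) 1.945910149055313306 := by
  have hl := sum_le_log_one_add_inv (a := 7) (by norm_num) 9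
  have hu := log_one_add_inv_le_sum_add (a := 7) (by norm_num) 9
  simp only [Finset.sum_range_succ, Finset.sum_range_zero] at hl hu
  have e : Real.log 7 = 3 * Real.log 2 - Real.log (1 + 7⁻¹) := by
    rw [← Real.log_rpow (by norm_num), ← Real.log_div (by norm_num) (by norm_num)]; norm_num
  obtain ⟨two_lo, two_hi⟩ := log_two_mem_Icc
  rw [e]
  generalize Real.log (1 + 7⁻¹) = S at hl hu
  generalize Real.log 2 = two at *
  norm_num at hl hu
  constructor <;> linarith

theorem log_eleven_mem_Icc :
    Real.log 11 ∈ Set.Icc (2.39789527279837054 : ℝ) 2.39789527279837055 := by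
  have hl := sum_le_log_one_add_inv (a := 10) (by norm_num) 8
  have hu := log_one_add_inv_le_sum_add (a := 10) (by norm_num) 8
  simp only [Finset.sum_range_succ, Finset.sum_range_zero] at hl hu
  have e : Real.log 11 = Real.log 2 + Real.log 5 + Real.log (1 + 10⁻¹) := by
    rw [← Real.log_mul (by norm_num) (by norm_num), ← Real.log_mul (by norm_num) (by norm_num)]; norm_num
  obtain ⟨two_lo, two_hi⟩ := log_two_mem_Icc
  obtain ⟨five_lo, five_hi⟩ := log_five_mem_Icc
  rw [e]
  generalize Real.log (1 + 10⁻¹) = S at hl hu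
  generalize Real.log 2 = two at *
  generalize Real.log 5 = five at *
  norm_num at hl hu
  constructor <;> linarith

theorem log_thirteen_mem_Icc :
    Real.log 13 ∈ Set.Icc (2.56494935746153673 : ℝ) 2.56494935746153674 := by
  have hl := sum_le_log_one_add_inv (a := 12) (by norm_num) 8
  have hu := log_one_add_inv_le_sum_add (a := 12) (by norm_num) 8
  simp only [Finset.sum_range_succ, Finset.sum_range_zero] at hl hu
  have e : Real.log 13 = 2 * Real.log 2 + Real.log 3 + Real.log (1 + 12⁻¹) := by
    rw [← Real.log_rpow (by norm_num), ← Real.log_mul (by norm_num) (by norm_num), ← Real.log_mul (by norm_num) (by norm_num)]; norm_num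
  obtain ⟨two_lo, two_hi⟩ := log_two_mem_Icc
  obtain ⟨three_lo, three_hi⟩ := log_three_mem_Icc
  rw [e]
  generalize Real.log (1 + 12⁻¹) = S at hl hu
  generalize Real.log 2 = two at *
  generalize Real.log 3 = three at *
  norm_num at hl hu
  constructor <;> linarith

/-! ### From monotone steps to bounds on the limits. -/

theorem le_of_tendsto_of_le_succ {f : ℕ → ℝ} {l : ℝ} (h : ∀ {n : ℕ}, 1 ≤ n → f n ≤ f (n + 1))
    (hl : Filter.Tendsto f Filter.atTop (nhds l)) {n : ℕ} (hn : 1 ≤ n) : f n ≤ l := by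
  have hm : Monotone fun k => f (k + 1) := monotone_nat_of_le_succ fun k => h (Nat.le_add_left 1 k)
  have := hm.ge_of_tendsto ((Filter.tendsto_add_atTop_iff_nat 1).mpr hl) (n - 1)
  rwa [Nat.sub_add_cancel hn] at this

theorem ge_of_tendsto_of_succ_le {f : ℕ → ℝ} {l : ℝ} (h : ∀ {n : ℕ}, 1 ≤ n → f (n + 1) ≤ f n)
    (hl : Filter.Tendsto f Filter.atTop (nhds l)) {n : ℕ} (hn : 1 ≤ n) : l ≤ f n :=
  neg_le_neg_iff.mp
    (le_of_tendsto_of_le_succ (f := fun k => -f k) (fun hk => neg_le_neg (h hk)) hl.neg hn)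

theorem tendsto_one_div_const_mul_pow (c : ℝ) {k : ℕ} (hk : k ≠ 0) :
    Filter.Tendsto (fun n : ℕ => 1 / (c * (n : ℝ) ^ k)) Filter.atTop (nhds 0) := by
  have h := ((tendsto_pow_neg_atTop (𝕜 := ℝ) hk).comp
    tendsto_natCast_atTop_atTop).const_mul (1 / c)
  rw [mul_zero] at h
  refine h.congr fun n => ?_
  simp [mul_comm]

theorem glaisherKinkelin_lower {n : ℕ} (hn : 1 ≤ n) :
    Real.log (glaisherKinkelinSeq n) - 1 / (720 * (n : ℝ) ^ 2) + 1 / (5040 * (n : ℝ) ^ 4) -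
        1 / (10080 * (n : ℝ) ^ 6) ≤ Real.log glaisherKinkelin := by
  have hl := ((tendsto_log_glaisherKinkelinSeq.sub (tendsto_one_div_const_mul_pow 720
    two_ne_zero)).add (tendsto_one_div_const_mul_pow 5040 four_ne_zero)).sub
    (tendsto_one_div_const_mul_pow 10080 (k := 6) (by norm_num))
  rw [sub_zero, add_zero, sub_zero] at hl
  exact le_of_tendsto_of_le_succ glaisherKinkelinSeq_lower_step hl hn

theorem glaisherKinkelin_upper {n : ℕ} (hn : 1 ≤ n) :
    Real.log glaisherKinkelin ≤
      Real.log (glaisherKinkelinSeq n) - 1 / (720 * (n : ℝ) ^ 2) + 1 / (5040 * (n : ℝ) ^ 4) := by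
  have hl := (tendsto_log_glaisherKinkelinSeq.sub (tendsto_one_div_const_mul_pow 720
    two_ne_zero)).add (tendsto_one_div_const_mul_pow 5040 four_ne_zero)
  rw [sub_zero, add_zero] at hl
  exact ge_of_tendsto_of_succ_le glaisherKinkelinSeq_upper_step hl hn

theorem eulerMascheroniConstant_lower {n : ℕ} (hn : 1 ≤ n) :
    (harmonic n : ℝ) - Real.log n - 1 / (2 * (n : ℝ)) + 1 / (12 * (n : ℝ) ^ 2) -
        1 / (120 * (n : ℝ) ^ 4) ≤ Real.eulerMascheroniConstant := by
  have h1 := tendsto_one_div_const_mul_pow 2 one_ne_zero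
  simp only [pow_one] at h1
  have hl := ((Real.tendsto_harmonic_sub_log.sub h1).add (tendsto_one_div_const_mul_pow 12
    two_ne_zero)).sub (tendsto_one_div_const_mul_pow 120 four_ne_zero)
  rw [sub_zero, add_zero, sub_zero] at hl
  exact le_of_tendsto_of_le_succ harmonic_lower_step hl hn

theorem eulerMascheroniConstant_upper {n : ℕ} (hn : 1 ≤ n) :
    Real.eulerMascheroniConstant ≤
      (harmonic n : ℝ) - Real.log n - 1 / (2 * (n : ℝ)) + 1 / (12 * (n : ℝ) ^ 2) -
        1 / (120 * (n : ℝ) ^ 4) + 1 / (252 * (n : ℝ) ^ 6) := by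
  have h1 := tendsto_one_div_const_mul_pow 2 one_ne_zero
  simp only [pow_one] at h1
  have hl := (((Real.tendsto_harmonic_sub_log.sub h1).add (tendsto_one_div_const_mul_pow 12
    two_ne_zero)).sub (tendsto_one_div_const_mul_pow 120 four_ne_zero)).add
    (tendsto_one_div_const_mul_pow 252 (k := 6) (by norm_num))
  rw [sub_zero, add_zero, sub_zero, add_zero] at hl
  exact ge_of_tendsto_of_succ_le harmonic_upper_step hl hn

/-! ### Decimal expansions. -/

theorem log_glaisherKinkelin_mem_Icc :
    Real.log glaisherKinkelin ∈ Set.Icc (0.2487544770335 : ℝ) 0.2487544770400 := by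
  -- At n = 16 the two bounds differ by 1/(10080 · 16⁶), about 6 · 10⁻¹².
  have hlo := glaisherKinkelin_lower (n := 16) (by norm_num)
  have hhi := glaisherKinkelin_upper (n := 16) (by norm_num)
  rw [log_glaisherKinkelinSeq (by norm_num)] at hlo hhi
  have l4 : Real.log 4 = 2 * Real.log 2 := by
    rw [show (4 : ℝ) = 2 ^ 2 by norm_num, Real.log_pow]; norm_num
  have l6 : Real.log 6 = Real.log 2 + Real.log 3 := by
    rw [← Real.log_mul (by norm_num) (by norm_num)]; norm_num
  have l8 : Real.log 8 = 3 * Real.log 2 := by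
    rw [show (8 : ℝ) = 2 ^ 3 by norm_num, Real.log_pow]; norm_num
  have l9 : Real.log 9 = 2 * Real.log 3 := by
    rw [show (9 : ℝ) = 3 ^ 2 by norm_num, Real.log_pow]; norm_num
  have l10 : Real.log 10 = Real.log 2 + Real.log 5 := by
    rw [← Real.log_mul (by norm_num) (by norm_num)]; norm_num
  have l12 : Real.log 12 = Real.log 4 + Real.log 3 := by
    rw [← Real.log_mul (by norm_num) (by norm_num)]; norm_num
  have l14 : Real.log 14 = Real.log 2 + Real.log 7 := by
    rw [← Real.log_mul (by norm_num) (by norm_num)]; norm_num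
  have l15 : Real.log 15 = Real.log 3 + Real.log 5 := by
    rw [← Real.log_mul (by norm_num) (by norm_num)]; norm_num
  have l16 : Real.log 16 = 4 * Real.log 2 := by
    rw [show (16 : ℝ) = 2 ^ 4 by norm_num, Real.log_pow]; norm_num
  simp [Finset.sum_Icc_succ_top] at hlo hhi
  rw [l16, l15, l14, l12, l10, l9, l8, l6, l4] at hlo hhi
  obtain ⟨a2, b2⟩ := log_two_mem_Icc
  obtain ⟨a3, b3⟩ := log_three_mem_Icc
  obtain ⟨a5, b5⟩ := log_five_mem_Icc
  obtain ⟨a7, b7⟩ := log_seven_mem_Icc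
  obtain ⟨a11, b11⟩ := log_eleven_mem_Icc
  obtain ⟨a13, b13⟩ := log_thirteen_mem_Icc
  constructor <;> linarith

theorem eulerMascheroniConstant_mem_Icc :
    Real.eulerMascheroniConstant ∈ Set.Icc (0.5772156646 : ℝ) 0.5772156649025 := by
  -- A power of two, so log 2 suffices. The gap of about 2.4 · 10⁻¹⁰ is harmless, since γ enters
  -- divided by 12.
  have hlo := eulerMascheroniConstant_lower (n := 16) (by norm_num)
  have hhi := eulerMascheroniConstant_upper (n := 16) (by norm_num)
  have l16 : Real.log (16 : ℕ) = 4 * Real.log 2 := by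
    rw [show ((16 : ℕ) : ℝ) = 2 ^ 4 by norm_num, Real.log_pow]; norm_num
  have h16 : harmonic 16 = 2436559 / 720720 := by
    norm_num [harmonic, Finset.sum_range_succ]
  rw [l16, h16] at hlo hhi
  push_cast at hlo hhi
  obtain ⟨a2, b2⟩ := log_two_mem_Icc
  constructor <;> linarith

theorem exp_div_glaisherKinkelin_mem_Ico :
    Real.exp ((1 - Real.eulerMascheroniConstant) / 12) / glaisherKinkelin ∈
      Set.Ico (0.8077340270 : ℝ) 0.8077340271 := by
  obtain ⟨a1, b1⟩ := log_glaisherKinkelin_mem_Icc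
  obtain ⟨a2, b2⟩ := eulerMascheroniConstant_mem_Icc
  have e : Real.exp ((1 - Real.eulerMascheroniConstant) / 12) / glaisherKinkelin =
      Real.exp ((1 - Real.eulerMascheroniConstant) / 12 - Real.log glaisherKinkelin) := by
    rw [Real.exp_sub, Real.exp_log glaisherKinkelin_pos]
  -- The two arguments are outward roundings of the range of (1 - γ)/12 - log A given by the
  -- enclosures.
  have hlo := Real.exp_bound (x := -0.21352244912) (by norm_num [abs_le]) (n := 12) (by norm_num)
  have hhi := Real.exp_bound (x := -0.21352244908) (by norm_num [abs_le]) (n := 12) (by norm_num)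
  rw [abs_le, abs_of_neg (by norm_num)] at hlo hhi
  have m1 : Real.exp (-0.21352244912) ≤
      Real.exp ((1 - Real.eulerMascheroniConstant) / 12 - Real.log glaisherKinkelin) :=
    Real.exp_le_exp.mpr (by linarith)
  have m2 : Real.exp ((1 - Real.eulerMascheroniConstant) / 12 - Real.log glaisherKinkelin) ≤
      Real.exp (-0.21352244908) := Real.exp_le_exp.mpr (by linarith)
  rw [e]
  refine ⟨le_trans ?_ m1, lt_of_le_of_lt m2 ?_⟩
  · have := hlo.1
    norm_num [Finset.sum_range_succ, Nat.factorial] at this ⊢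
    linarith
  · have := hhi.2
    norm_num [Finset.sum_range_succ, Nat.factorial] at this ⊢
    linarith

theorem glaisherKinkelin_mem_Icc :
    glaisherKinkelin ∈ Set.Icc (1.2824271291002 : ℝ) 1.2824271291100 := by
  obtain ⟨a1, b1⟩ := log_glaisherKinkelin_mem_Icc
  have hlo := Real.exp_bound (x := 0.2487544770335) (by norm_num [abs_le]) (n := 12) (by norm_num)
  have hhi := Real.exp_bound (x := 0.2487544770400) (by norm_num [abs_le]) (n := 12) (by norm_num)
  rw [abs_le, abs_of_pos (by norm_num)] at hlo hhi
  have m1 := Real.exp_le_exp.mpr a1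
  have m2 := Real.exp_le_exp.mpr b1
  rw [Real.exp_log glaisherKinkelin_pos] at m1 m2
  refine ⟨le_trans ?_ m1, m2.trans ?_⟩
  · have := hlo.1
    norm_num [Finset.sum_range_succ, Nat.factorial] at this ⊢
    linarith
  · have := hhi.2
    norm_num [Finset.sum_range_succ, Nat.factorial] at this ⊢
    linarith

theorem rpow_div_glaisherKinkelin_mem_Ico :
    (2 * Real.pi) ^ (1 / 4 : ℝ) / glaisherKinkelin ∈
      Set.Ico (1.2345601953 : ℝ) 1.2345601954 := by
  obtain ⟨a, b⟩ := glaisherKinkelin_mem_Icc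
  have hA := glaisherKinkelin_pos
  have hpi : (0 : ℝ) ≤ 2 * Real.pi := by positivity
  -- Comparing fourth powers reduces both bounds to known digits of π.
  have h4 : ((2 * Real.pi) ^ (1 / 4 : ℝ)) ^ 4 = 2 * Real.pi := by
    rw [← Real.rpow_natCast, ← Real.rpow_mul hpi]
    norm_num
  constructor
  · rw [le_div_iff₀ hA]
    refine (mul_le_mul_of_nonneg_left b (by norm_num)).trans ?_
    refine le_of_pow_le_pow_left₀ four_ne_zero (by positivity) ?_
    rw [h4]
    have := Real.pi_gt_d20
    norm_num at this ⊢
    linarith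
  · rw [div_lt_iff₀ hA]
    refine lt_of_lt_of_le ?_ (mul_le_mul_of_nonneg_left a (by norm_num))
    refine lt_of_pow_lt_pow_left₀ 4 (by norm_num) ?_
    rw [h4]
    have := Real.pi_lt_d20
    norm_num at this ⊢
    linarith

theorem mainTheorem6 :
    Filter.Tendsto
      (fun n : ℕ =>
        (∏ ν ∈ Finset.Icc 1 (n - 1), Real.Gamma ((ν : ℝ) / (n : ℝ)) ^ ν) /
          (Real.exp ((1 - Real.eulerMascheroniConstant) / 12) / glaisherKinkelin *
              ((2 * Real.pi) ^ (1 / 4 : ℝ) / glaisherKinkelin) ^ (n ^ 2) /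
            (n : ℝ) ^ (1 / 12 : ℝ)))
      Filter.atTop (nhds 1) ∧
    Real.exp ((1 - Real.eulerMascheroniConstant) / 12) / glaisherKinkelin ∈
      Set.Ico (0.8077340270 : ℝ) 0.8077340271 ∧
    (2 * Real.pi) ^ (1 / 4 : ℝ) / glaisherKinkelin ∈
      Set.Ico (1.2345601953 : ℝ) 1.2345601954 := by
  exact ⟨tendsto_prod_Gamma_pow_div, exp_div_glaisherKinkelin_mem_Ico,
    rpow_div_glaisherKinkelin_mem_Ico⟩
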